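/- Let $G$ be a finite group with centre $Z(G)$, let $z=|Z(G)|$, and suppose $G/Z(G)\cong D_{2n}$, the dihedral group of order $2n$, where $n\ge 3$ (so $G$ is non-abelian). The CCC-graph $\Gamma_G$ is the simple graph whose vertices are the conjugacy classes of the non-central elements of $G$, two distinct classes being adjacent if and only if some element of one commutes with some element of the other. For a finite graph $\mathcal{G}$ with vertices $v_1,\dots,v_N$, let $CN(\mathcal G)$ be the $N\times N$ matrix with zero diagonal whose $(i,j)$ entry for $i\ne j$ is the number of common neighbours of $v_i$ and $v_j$, let $CNRS(\mathcal G)$ be the diagonal matrix of the row sums of $CN(\mathcal G)$, and let $\Delta=\operatorname{tr}(CNRS(\mathcal G))/N$. The CNL-energy (respectively CNSL-energy) of $\mathcal G$ is $\sum_i|\lambda_i-\Delta|$, where $\lambda_1,\dots,\lambda_N$ are the eigenvalues, with multiplicity, of $CNRS(\mathcal G)-CN(\mathcal G)$ (respectively of $CNRS(\mathcal G)+CN(\mathcal G)$). The graph $\mathcal G$ is CNL-hyperenergetic (CNSL-hyperenergetic) if its CNL-energy (CNSL-energy) is greater than $2(N-1)(N-2)$, and CNL-borderenergetic (CNSL-borderenergetic)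 if it is equal to $2(N-1)(N-2)$. Then: 1. $\Gamma_G$ is CNL-borderenergetic if and only if $n\in\{3,11\}$ and $z=1$. 2. $\Gamma_G$ is CNL-hyperenergetic if and only if $(n,z)$ is neither $(3,1)$ nor $(11,1)$ and none of the following holds: $n\in\{4,6\}$ and $z=2$; $n=4$ and $z\in\{3,4\}$; $n=3$ and $z\ge 2$; $n\in\{5,7,9\}$ and $z=1$; $n=5$ and $z\in\{2,3\}$. 3. $\Gamma_G$ is CNSL-borderenergetic if and only if $n=3$ and $z=1$. 4. $\Gamma_G$ is CNSL-hyperenergetic if and only if $(n,z)\ne(3,1)$ and none of the following holds: $n=4$ and $z\in\{2,3,4,5\}$; $n\in\{6,8\}$ and $z=2$; $n=6$ and $z=3$; $n=5$ and $z=1$; $n=3$ and $z\ge 2$; $n\ge 7$ odd and $z=1$; $n\in\{5,7,9\}$ and $z=2$; $n=5$ and $z\in\{3,4\}$. -/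

import Mathlib

noncomputable section

namespace CCC

/-- The vertices of the CCC-graph: conjugacy classes of non-central elements. -/
abbrev Vertex (G : Type*) [Group G] : Type _ :=
  {c : ConjClasses G // ∃ x : G, x ∉ Subgroup.center G ∧ ConjClasses.mk x = c}

instance (G : Type*) [Group G] [Finite G] : Fintype (Vertex G) := by
  haveI : Finite (ConjClasses G) := Finite.of_surjective _ ConjClasses.mk_surjective
  exact Fintype.ofFinite _

/-- The commuting conjugacy class graph (CCC-graph) of a group. -/
def graph (G : Type*) [Group G] : SimpleGraph (Vertex G) where
  Adj c d := c ≠ d ∧ ∃ x y : G, ConjClasses.mk x = c.1 ∧ ConjClasses.mk y = d.1 ∧ x * y = y * x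
  symm := ⟨fun _ _ ⟨hne, x, y, hx, hy, h⟩ => ⟨hne.symm, y, x, hy, hx, h.symm⟩⟩
  loopless := ⟨fun _ h => h.1 rfl⟩

end CCC

namespace SimpleGraph

variable {V : Type*} [Fintype V] (Γ : SimpleGraph V)

open scoped Classical in
/-- The common neighborhood matrix; a common neighbor of `v` and `w` is automatically
different from both. -/
def cnMatrix : Matrix V V ℝ :=
  Matrix.of fun v w => if v = w then 0 else ((Γ.commonNeighbors v w).ncard : ℝ)

open scoped Classical in
/-- The diagonal matrix of the row sums of the common neighborhood matrix. -/
def cnrsMatrix : Matrix V V ℝ :=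
  Matrix.diagonal fun v => ∑ w, Γ.cnMatrix v w

/-- The common neighborhood Laplacian matrix. -/
def cnlMatrix : Matrix V V ℝ := Γ.cnrsMatrix - Γ.cnMatrix

/-- The common neighborhood signless Laplacian matrix. -/
def cnslMatrix : Matrix V V ℝ := Γ.cnrsMatrix + Γ.cnMatrix

open scoped Classical in
/-- The CNL-spectrum: the eigenvalues of the (real symmetric) CNL-matrix, with multiplicities. -/
def cnlSpectrum : Multiset ℝ := Γ.cnlMatrix.charpoly.roots

open scoped Classical in
/-- The CNSL-spectrum: the eigenvalues of the (real symmetric) CNSL-matrix, with multiplicities. -/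
def cnslSpectrum : Multiset ℝ := Γ.cnslMatrix.charpoly.roots

/-- The average `tr(CNRS) / |V|`. -/
def cnDelta : ℝ := Γ.cnrsMatrix.trace / (Fintype.card V : ℝ)

/-- The CNL-energy. -/
def cnlEnergy : ℝ := (Γ.cnlSpectrum.map fun a => |a - Γ.cnDelta|).sum

/-- The CNSL-energy. -/
def cnslEnergy : ℝ := (Γ.cnslSpectrum.map fun b => |b - Γ.cnDelta|).sum

/-- CNL-hyperenergetic: the CNL-energy exceeds `2 (N - 1) (N - 2)`, with `N` the order. -/
def CNLHyperenergetic : Prop :=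
  Γ.cnlEnergy > 2 * ((Fintype.card V : ℝ) - 1) * ((Fintype.card V : ℝ) - 2)

/-- CNSL-hyperenergetic: the CNSL-energy exceeds `2 (N - 1) (N - 2)`, with `N` the order. -/
def CNSLHyperenergetic : Prop :=
  Γ.cnslEnergy > 2 * ((Fintype.card V : ℝ) - 1) * ((Fintype.card V : ℝ) - 2)

/-- CNL-borderenergetic: the CNL-energy equals `2 (N - 1) (N - 2)`, with `N` the order. -/
def CNLBorderenergetic : Prop :=
  Γ.cnlEnergy = 2 * ((Fintype.card V : ℝ) - 1) * ((Fintype.card V : ℝ) - 2)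

/-- CNSL-borderenergetic: the CNSL-energy equals `2 (N - 1) (N - 2)`, with `N` the order. -/
def CNSLBorderenergetic : Prop :=
  Γ.cnslEnergy = 2 * ((Fintype.card V : ℝ) - 1) * ((Fintype.card V : ℝ) - 2)

end SimpleGraph

end

/-!
Write `φ : G → D_{2n}` for the quotient map and `r = gcd n 2`. A noncentral element over a rotation
commutes exactly with the elements over rotations, and one over a reflection `s` exactly with those
over `1` and `s`; the reflections themselves form `r` conjugacy classes. So the classes over
rotations form one clique, those over each kind of reflections form another, and there are no
further edges. Counting elements against class sizes (`2` over rotations, `n` over reflections)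
gives `Γ_G = K_{tb} ∪ r K_b` with `t = r (n - 1) / 2` and `b = z / r`.

On a disjoint union of cliques the matrices `CNRS ± CN` are block diagonal with blocks of the form
`x I + y J`, so all eigenvalues are explicit. For `t ≥ 2`, once it is known which eigenvalues exceed
the mean `Δ`, the energy minus the bound `2 (N - 1) (N - 2)` is a positive multiple of a polynomial
in `t`, `b` and `r`, which is positive for all but finitely many pairs `(t, b)`; the remaining ones
are evaluated. The CNSL-energy of `K_t ∪ K_1`, and that of `K_3 ∪ 2 K_1`, is not covered by this
formula but is always below the bound. For `n = 3` the graph consists of two equal cliques, and both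
energies fall short of the bound by `4 (z ^ 2 - 1)`.
-/

namespace CCC

section CharacteristicPolynomial

open Polynomial

variable {R V I : Type*} [CommRing R] [Fintype V] [DecidableEq V]

theorem charpoly_const_diag_const_offDiag [Nonempty V] (c d : R) :
    (Matrix.of fun i j : V => if i = j then c else d).charpoly =
      (X - C (c - d)) ^ (Fintype.card V - 1) * (X - C (c + (Fintype.card V - 1) * d)) := by
  have rank_one_sub_scalar : (Matrix.of fun i j : V => if i = j then c else d) =
      Matrix.vecMulVec (fun _ => d) (fun _ => 1) - Matrix.scalar V (d - c) := by
    ext i j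
    by_cases hij : i = j <;> simp [hij, Matrix.vecMulVec_apply]
  obtain ⟨k, hk⟩ := Nat.exists_eq_add_of_le (Fintype.card_pos (α := V))
  rw [rank_one_sub_scalar, Matrix.charpoly_sub_scalar, Matrix.charpoly_vecMulVec, hk]
  simp [dotProduct, hk, smul_eq_C_mul]
  ring

theorem roots_charpoly_const_diag_const_offDiag [IsDomain R] [Nonempty V] (c d : R) :
    (Matrix.of fun i j : V => if i = j then c else d).charpoly.roots =
      (c + (Fintype.card V - 1) * d) ::ₘ Multiset.replicate (Fintype.card V - 1) (c - d) := by
  rw [charpoly_const_diag_const_offDiag,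
    roots_mul (mul_ne_zero (pow_ne_zero _ (X_sub_C_ne_zero _)) (X_sub_C_ne_zero _)),
    roots_pow, roots_X_sub_C, roots_X_sub_C, Multiset.nsmul_singleton, add_comm,
    Multiset.singleton_add]

theorem charpoly_eq_prod_charpoly_toSquareBlock [Fintype I] [DecidableEq I] {M : Matrix V V R}
    {f : V → I} (h : ∀ v w, f v ≠ f w → M v w = 0) :
    M.charpoly = ∏ i, (M.toSquareBlock f i).charpoly := by
  let order : LinearOrder I := IsWellOrder.linearOrder WellOrderingRel
  obtain rfl : ‹DecidableEq I› = order.toDecidableEq := Subsingleton.elim _ _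
  have triangular : M.BlockTriangular f := fun v w hvw => h v w hvw.ne'
  rw [triangular.charpoly]
  refine (Finset.prod_subset (Finset.subset_univ _) fun i _ hi => ?_).trans ?_
  · have : IsEmpty {v // f v = i} :=
      ⟨fun v => hi (Finset.mem_image.2 ⟨v, Finset.mem_univ _, v.2⟩)⟩
    exact Matrix.charpoly_isEmpty
  · rfl

end CharacteristicPolynomial

/-- `Γ` is a disjoint union of complete graphs: its components are the fibres of the labelling
`f`, and the component with label `i` has `m i` vertices. -/
structure IsCliqueUnion {V I : Type*} (Γ : SimpleGraph V) (f : V → I) (m : I → ℕ) : Prop where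
  adj_iff (v w : V) : Γ.Adj v w ↔ v ≠ w ∧ f v = f w
  card_fiber (i : I) : Nat.card {v // f v = i} = m i

/-- The contribution of a component `K_m` to the energy of a graph, where `ε = -1` for the
CNL-energy, `ε = 1` for the CNSL-energy, and `Δ` is the average row sum of the whole graph. -/
noncomputable def cliqueEnergy (ε Δ m : ℝ) : ℝ :=
  |(1 + ε) * ((m - 1) * (m - 2)) - Δ| + (m - 1) * |(m - 1 - ε) * (m - 2) - Δ|

namespace IsCliqueUnion

variable {V I : Type*} {Γ : SimpleGraph V} {f : V → I} {m : I → ℕ}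

theorem ncard_setOf_label_eq (H : IsCliqueUnion Γ f m) (i : I) : {v | f v = i}.ncard = m i :=
  H.card_fiber i

theorem ncard_commonNeighbors [Finite V] (H : IsCliqueUnion Γ f m) {v w : V} (hvw : v ≠ w)
    (hf : f v = f w) : ((Γ.commonNeighbors v w).ncard : ℝ) = m (f v) - 2 := by
  have hset : Γ.commonNeighbors v w = {u | f u = f v} \ {v, w} := by
    ext u
    simp only [SimpleGraph.mem_commonNeighbors, H.adj_iff, Set.mem_sdiff, Set.mem_ofPred_eq,
      Set.mem_insert_iff, Set.mem_singleton_iff]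
    grind
  have hsub : ({v, w} : Set V) ⊆ {u | f u = f v} := by
    rintro u (rfl | rfl)
    exacts [rfl, hf.symm]
  have hcard := Set.ncard_sdiff_add_ncard_of_subset hsub
  rw [Set.ncard_pair hvw, H.ncard_setOf_label_eq, ← hset] at hcard
  rw [← hcard]
  push_cast
  ring

theorem commonNeighbors_eq_empty (H : IsCliqueUnion Γ f m) {v w : V} (hf : f v ≠ f w) :
    Γ.commonNeighbors v w = ∅ := by
  refine Set.eq_empty_of_forall_notMem fun u hu => hf ?_
  rw [SimpleGraph.mem_commonNeighbors, H.adj_iff, H.adj_iff] at hu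
  exact hu.1.2.trans hu.2.2.symm

open scoped Classical in
theorem cnMatrix_apply [Finite V] (H : IsCliqueUnion Γ f m) (v w : V) :
    Γ.cnMatrix v w = if v = w then 0 else if f v = f w then (m (f v) : ℝ) - 2 else 0 := by
  simp only [SimpleGraph.cnMatrix, Matrix.of_apply]
  split_ifs with hvw hf
  · rfl
  · exact H.ncard_commonNeighbors hvw hf
  · simp [H.commonNeighbors_eq_empty hf]

variable [Fintype V]

theorem sum_comp [Fintype I] (H : IsCliqueUnion Γ f m) (g : I → ℝ) :
    ∑ v, g (f v) = ∑ i, m i * g i := by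
  classical
  rw [← Fintype.sum_fiberwise f]
  refine Finset.sum_congr rfl fun i _ => ?_
  rw [Finset.sum_congr rfl (g := fun _ => g i) fun v _ => congrArg g v.2, Finset.sum_const,
    nsmul_eq_mul, Finset.card_univ, ← Nat.card_eq_fintype_card, H.card_fiber]

theorem card_eq [Fintype I] (H : IsCliqueUnion Γ f m) :
    (Fintype.card V : ℝ) = ∑ i, (m i : ℝ) := by
  simpa using H.sum_comp fun _ => 1

theorem sum_cnMatrix (H : IsCliqueUnion Γ f m) (v : V) :
    ∑ w, Γ.cnMatrix v w = ((m (f v) : ℝ) - 1) * (m (f v) - 2) := by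
  classical
  let K := Finset.univ.filter fun w => f w = f v
  have hv : v ∈ K := by simp [K]
  have hK : K.card = m (f v) := by
    rw [← H.card_fiber, Nat.card_eq_fintype_card, Fintype.card_subtype]
  have hentry (w : V) : Γ.cnMatrix v w = if w ∈ K.erase v then (m (f v) : ℝ) - 2 else 0 := by
    rw [H.cnMatrix_apply]
    simp only [K, Finset.mem_erase, Finset.mem_filter, Finset.mem_univ, true_and]
    grind
  simp_rw [hentry]
  rw [Finset.sum_ite_mem, Finset.univ_inter, Finset.sum_const, nsmul_eq_mul,
    Finset.cast_card_erase_of_mem hv, hK]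

theorem cnDelta_eq [Fintype I] (H : IsCliqueUnion Γ f m) :
    Γ.cnDelta = (∑ i, (m i : ℝ) * ((m i - 1) * (m i - 2))) / ∑ i, (m i : ℝ) := by
  classical
  rw [SimpleGraph.cnDelta, SimpleGraph.cnrsMatrix, Matrix.trace_diagonal, H.card_eq]
  simp_rw [H.sum_cnMatrix]
  rw [H.sum_comp fun i => ((m i : ℝ) - 1) * (m i - 2)]

open scoped Classical in
theorem cnrsMatrix_add_smul_cnMatrix_apply (H : IsCliqueUnion Γ f m) (ε : ℝ) (v w : V) :
    (Γ.cnrsMatrix + ε • Γ.cnMatrix) v w =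
      if v = w then ((m (f v) : ℝ) - 1) * (m (f v) - 2)
      else if f v = f w then ε * ((m (f v) : ℝ) - 2) else 0 := by
  rw [Matrix.add_apply, Matrix.smul_apply, SimpleGraph.cnrsMatrix, Matrix.diagonal_apply,
    H.sum_cnMatrix, H.cnMatrix_apply, smul_eq_mul]
  split_ifs <;> simp

open scoped Classical in
theorem roots_charpoly [Fintype I] (H : IsCliqueUnion Γ f m) (hm : ∀ i, m i ≠ 0) (ε : ℝ) :
    (Γ.cnrsMatrix + ε • Γ.cnMatrix).charpoly.roots = Finset.univ.val.bind fun i =>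
      ((1 + ε) * (((m i : ℝ) - 1) * (m i - 2))) ::ₘ
        Multiset.replicate (m i - 1) (((m i : ℝ) - 1 - ε) * (m i - 2)) := by
  rw [charpoly_eq_prod_charpoly_toSquareBlock (f := f) fun v w hvw => by
      rw [H.cnrsMatrix_add_smul_cnMatrix_apply, if_neg (ne_of_apply_ne f hvw), if_neg hvw],
    Polynomial.roots_prod _ _ (Finset.prod_ne_zero_iff.2 fun i _ =>
      (Matrix.charpoly_monic _).ne_zero)]
  refine Multiset.bind_congr fun i _ => ?_
  have hcard : Fintype.card {v // f v = i} = m i :=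
    Nat.card_eq_fintype_card.symm.trans (H.card_fiber i)
  have : Nonempty {v // f v = i} := Fintype.card_pos_iff.1 (hcard ▸ Nat.pos_of_ne_zero (hm i))
  have hblock : (Γ.cnrsMatrix + ε • Γ.cnMatrix).toSquareBlock f i =
      Matrix.of fun v w => if v = w then ((m i : ℝ) - 1) * (m i - 2) else ε * ((m i : ℝ) - 2) := by
    ext ⟨v, hv⟩ ⟨w, hw⟩
    rw [Matrix.toSquareBlock_def, Matrix.of_apply, H.cnrsMatrix_add_smul_cnMatrix_apply]
    simp [hv, hw]
  rw [hblock, roots_charpoly_const_diag_const_offDiag, hcard]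
  congr 2 <;> ring

open scoped Classical in
theorem sum_abs_roots_charpoly_sub [Fintype I] (H : IsCliqueUnion Γ f m) (hm : ∀ i, m i ≠ 0)
    (ε Δ : ℝ) :
    ((Γ.cnrsMatrix + ε • Γ.cnMatrix).charpoly.roots.map fun a => |a - Δ|).sum =
      ∑ i, cliqueEnergy ε Δ (m i) := by
  rw [H.roots_charpoly hm, Multiset.map_bind, Multiset.sum_bind]
  refine congrArg Multiset.sum (Multiset.map_congr rfl fun i _ => ?_)
  rw [Multiset.map_cons, Multiset.sum_cons, Multiset.map_replicate, Multiset.sum_replicate,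
    nsmul_eq_mul, Nat.cast_pred (Nat.pos_of_ne_zero (hm i)), cliqueEnergy]

theorem cnlEnergy_eq [Fintype I] (H : IsCliqueUnion Γ f m) (hm : ∀ i, m i ≠ 0) :
    Γ.cnlEnergy = ∑ i, cliqueEnergy (-1) Γ.cnDelta (m i) := by
  rw [← H.sum_abs_roots_charpoly_sub hm, neg_one_smul, ← sub_eq_add_neg]
  rfl

theorem cnslEnergy_eq [Fintype I] (H : IsCliqueUnion Γ f m) (hm : ∀ i, m i ≠ 0) :
    Γ.cnslEnergy = ∑ i, cliqueEnergy 1 Γ.cnDelta (m i) := by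
  rw [← H.sum_abs_roots_charpoly_sub hm, one_smul]
  rfl

end IsCliqueUnion

section CliqueEnergy

variable {Δ m : ℝ}

theorem cliqueEnergy_neg_one_of_le_mean (hΔ : 0 ≤ Δ) (h : m * (m - 2) ≤ Δ) :
    cliqueEnergy (-1) Δ m = m * Δ - m * ((m - 1) * (m - 2)) := by
  rw [cliqueEnergy, abs_of_nonpos (by linarith), abs_of_nonpos (by linarith)]
  ring

theorem cliqueEnergy_neg_one_of_mean_le (hΔ : 0 ≤ Δ) (h : Δ ≤ m * (m - 2)) :
    cliqueEnergy (-1) Δ m = m * ((m - 1) * (m - 2)) - (m - 2) * Δ := by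
  rw [cliqueEnergy, abs_of_nonpos (by linarith), abs_of_nonneg (by linarith)]
  ring

theorem cliqueEnergy_one_of_le_mean (h : 2 * ((m - 1) * (m - 2)) ≤ Δ) (h' : (m - 2) ^ 2 ≤ Δ) :
    cliqueEnergy 1 Δ m = m * Δ - m * ((m - 1) * (m - 2)) := by
  rw [cliqueEnergy, abs_of_nonpos (by linarith), abs_of_nonpos (by linarith)]
  ring

theorem cliqueEnergy_one_of_mean_le (h : Δ ≤ 2 * ((m - 1) * (m - 2))) (h' : Δ ≤ (m - 2) ^ 2) :
    cliqueEnergy 1 Δ m = m * ((m - 1) * (m - 2)) - m * Δ := by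
  rw [cliqueEnergy, abs_of_nonneg (by linarith), abs_of_nonneg (by linarith)]
  ring

theorem cliqueEnergy_one_one (hΔ : 0 ≤ Δ) : cliqueEnergy 1 Δ 1 = Δ := by
  rw [cliqueEnergy, abs_of_nonpos (by linarith)]
  ring

theorem cliqueEnergy_one_of_le_mean_of_mean_le (h : Δ ≤ 2 * ((m - 1) * (m - 2)))
    (h' : (m - 2) ^ 2 ≤ Δ) :
    cliqueEnergy 1 Δ m = m * Δ - 2 * Δ + (m - 1) * (m - 2) * (4 - m) := by
  rw [cliqueEnergy, abs_of_nonneg (by linarith), abs_of_nonpos (by linarith)]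
  ring

theorem cliqueEnergy_self {ε : ℝ} (hε : |ε| = 1) (hm : 1 ≤ m) (h : 0 ≤ (m - 1) * (m - 2)) :
    cliqueEnergy ε ((m - 1) * (m - 2)) m = 2 * ((m - 1) * (m - 2)) := by
  have rank_one_term : |(1 + ε) * ((m - 1) * (m - 2)) - (m - 1) * (m - 2)| =
      (m - 1) * (m - 2) := by
    rw [one_add_mul, add_sub_cancel_left, abs_mul, hε, one_mul, abs_of_nonneg h]
  have scalar_term : (m - 1) * |(m - 1 - ε) * (m - 2) - (m - 1) * (m - 2)| =
      (m - 1) * (m - 2) := by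
    rw [← sub_mul, sub_sub_cancel_left, abs_mul, abs_neg, hε, one_mul, ← abs_of_nonneg h, abs_mul,
      abs_of_nonneg (sub_nonneg.2 hm)]
  rw [cliqueEnergy, rank_one_term, scalar_term, two_mul]

end CliqueEnergy

section MeanRowSum

/-- The average row sum of the common neighbourhood matrix of `K_{tb} ∪ r K_b`, where a common
factor `b` has been cancelled from the trace and the number of vertices. -/
noncomputable def meanRowSum (t b r : ℝ) : ℝ :=
  (t * ((t * b - 1) * (t * b - 2)) + r * ((b - 1) * (b - 2))) / (t + r)

/-- The amount by which the CNSL-energy of `K_{tb} ∪ r K_b` exceeds that of the complete graph on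
equally many vertices, up to the positive factor `2 / (t + r)`. For `2 ≤ t` this
needs that no eigenvalue of `K_{tb}` is below `meanRowSum t b r`, which fails if `b = 1` and
`r * (t - 2) < t`. -/
def cnslExcess (t b r : ℝ) : ℝ :=
  t * r * b ^ 2 * (t - 1) * (b * (t + 1) - 3) - (t + r) * (((t + r) * b - 1) * ((t + r) * b - 2))

/-- The amount by which the CNL-energy of `K_{tb} ∪ r K_b` exceeds that of the complete graph on
equally many vertices, up to the positive factor `2 / (t + r)`. -/
def cnlExcess (t b r : ℝ) : ℝ :=
  cnslExcess t b r + t * ((t * b - 1) * (t * b - 2)) + r * ((b - 1) * (b - 2))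

variable {t b r : ℝ}

theorem sub_one_mul_sub_two_le_of_two_le (ht : 2 ≤ t) (hb : 1 ≤ b) :
    (b - 1) * (b - 2) ≤ (t * b - 1) * (t * b - 2) := by
  nlinarith [mul_le_mul_of_nonneg_right ht (by linarith : 0 ≤ b)]

theorem add_mul_meanRowSum (h : t + r ≠ 0) :
    (t + r) * meanRowSum t b r = t * ((t * b - 1) * (t * b - 2)) + r * ((b - 1) * (b - 2)) :=
  mul_div_cancel₀ _ h

theorem le_two_mul_meanRowSum (ht : 2 ≤ t) (hb : 1 ≤ b) (hr : 0 < r) (hrt : r ≤ t) :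
    (t * b - 1) * (t * b - 2) + (b - 1) * (b - 2) ≤ 2 * meanRowSum t b r := by
  rw [meanRowSum, ← mul_div_assoc, le_div_iff₀ (by positivity)]
  have larger_clique := sub_one_mul_sub_two_le_of_two_le ht hb
  nlinarith

theorem meanRowSum_le (ht : 2 ≤ t) (hb : 1 ≤ b) (hr : 0 < r) :
    meanRowSum t b r ≤ (t * b - 1) * (t * b - 2) := by
  rw [meanRowSum, div_le_iff₀ (by positivity)]
  have larger_clique := sub_one_mul_sub_two_le_of_two_le ht hb
  nlinarith

theorem cliqueEnergy_neg_one_add (ht : 2 ≤ t) (hb : 1 ≤ b) (hr : 0 < r) (hrt : r ≤ t) :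
    cliqueEnergy (-1) (meanRowSum t b r) (t * b) + r * cliqueEnergy (-1) (meanRowSum t b r) b =
      2 * ((t + r) * b - 1) * ((t + r) * b - 2) + 2 * cnlExcess t b r / (t + r) := by
  have hM : 2 * b ≤ t * b := mul_le_mul_of_nonneg_right ht (by linarith)
  have lower := le_two_mul_meanRowSum ht hb hr hrt
  have upper := meanRowSum_le ht hb hr
  rw [cliqueEnergy_neg_one_of_mean_le (by nlinarith) (by linarith),
    cliqueEnergy_neg_one_of_le_mean (by nlinarith) (by nlinarith), cnlExcess, cnslExcess,
    meanRowSum]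
  field_simp
  ring

theorem cliqueEnergy_one_of_le_meanRowSum (ht : 2 ≤ t) (hb : b = 1 ∨ 2 ≤ b) (hr : 0 < r)
    (hrt : r ≤ t) : cliqueEnergy 1 (meanRowSum t b r) b =
      b * meanRowSum t b r - b * ((b - 1) * (b - 2)) := by
  have hb1 : 1 ≤ b := hb.elim Eq.ge one_le_two.trans
  have hM : 2 * b ≤ t * b := mul_le_mul_of_nonneg_right ht (by linarith)
  have lower := le_two_mul_meanRowSum ht hb1 hr hrt
  rcases hb with rfl | hb2
  · rw [cliqueEnergy_one_one (by nlinarith)]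
    ring
  · exact cliqueEnergy_one_of_le_mean (by nlinarith) (by nlinarith)

theorem meanRowSum_le_sq (ht : 2 ≤ t) (hb : 2 ≤ b) (hr : 1 ≤ r) :
    meanRowSum t b r ≤ (t * b - 2) ^ 2 := by
  rw [meanRowSum, div_le_iff₀ (by positivity)]
  obtain ⟨x, hx, rfl⟩ := exists_nonneg_add_of_le ht
  obtain ⟨y, hy, rfl⟩ := exists_nonneg_add_of_le hb
  obtain ⟨w, hw, rfl⟩ := exists_nonneg_add_of_le hr
  rw [← sub_nonneg]
  ring_nf
  positivity

theorem meanRowSum_one_le_sq (ht : 2 ≤ t) (hr : 0 < r) (h : t ≤ r * (t - 2)) :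
    meanRowSum t 1 r ≤ (t * 1 - 2) ^ 2 := by
  rw [meanRowSum, div_le_iff₀ (by positivity)]
  nlinarith

theorem sq_le_meanRowSum_one (ht : 2 ≤ t) (hr : 0 < r) (h : r * (t - 2) ≤ t) :
    (t - 2) ^ 2 ≤ meanRowSum t 1 r := by
  rw [meanRowSum, le_div_iff₀ (by positivity)]
  nlinarith

theorem cliqueEnergy_one_add (ht : 2 ≤ t) (hb : b = 1 ∨ 2 ≤ b) (hr : 0 < r) (hrt : r ≤ t)
    (hΔ : meanRowSum t b r ≤ (t * b - 2) ^ 2) :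
    cliqueEnergy 1 (meanRowSum t b r) (t * b) + r * cliqueEnergy 1 (meanRowSum t b r) b =
      2 * ((t + r) * b - 1) * ((t + r) * b - 2) + 2 * cnslExcess t b r / (t + r) := by
  have hb1 : 1 ≤ b := hb.elim Eq.ge one_le_two.trans
  rw [cliqueEnergy_one_of_mean_le (by nlinarith) hΔ,
    cliqueEnergy_one_of_le_meanRowSum ht hb hr hrt, cnslExcess, meanRowSum]
  field_simp
  ring

theorem cliqueEnergy_one_add_lt (ht : 2 ≤ t) (hr : 1 ≤ r) (h : r * (t - 2) ≤ t) :
    cliqueEnergy 1 (meanRowSum t 1 r) t + r * cliqueEnergy 1 (meanRowSum t 1 r) 1 <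
      2 * (t + r - 1) * (t + r - 2) := by
  have mean_ge := sq_le_meanRowSum_one ht (by linarith) h
  have mean_eq := add_mul_meanRowSum (t := t) (b := 1) (r := r) (by positivity)
  have upper := meanRowSum_le ht le_rfl (by linarith : 0 < r)
  rw [mul_one] at upper
  rw [cliqueEnergy_one_one (by nlinarith),
    cliqueEnergy_one_of_le_mean_of_mean_le (by nlinarith) mean_ge]
  nlinarith

end MeanRowSum

section ExcessSigns

variable {t b : ℝ}

theorem cnlExcess_one_pos (h : 6 ≤ t ∧ 1 ≤ b ∨ 3 ≤ t ∧ 2 ≤ b ∨ 2 ≤ t ∧ 4 ≤ b) :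
    0 < cnlExcess t b 1 := by
  rcases h with ⟨ht, hb⟩ | ⟨ht, hb⟩ | ⟨ht, hb⟩ <;>
  · obtain ⟨x, hx, rfl⟩ := exists_nonneg_add_of_le ht
    obtain ⟨y, hy, rfl⟩ := exists_nonneg_add_of_le hb
    rw [cnlExcess, cnslExcess]
    ring_nf
    positivity

theorem cnslExcess_one_pos (h : 5 ≤ t ∧ 2 ≤ b ∨ 3 ≤ t ∧ 3 ≤ b ∨ 2 ≤ t ∧ 5 ≤ b) :
    0 < cnslExcess t b 1 := by
  rcases h with ⟨ht, hb⟩ | ⟨ht, hb⟩ | ⟨ht, hb⟩ <;>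
  · obtain ⟨x, hx, rfl⟩ := exists_nonneg_add_of_le ht
    obtain ⟨y, hy, rfl⟩ := exists_nonneg_add_of_le hb
    rw [cnslExcess]
    ring_nf
    positivity

theorem cnlExcess_two_pos (h : 6 ≤ t ∧ 1 ≤ b ∨ 4 ≤ t ∧ 2 ≤ b ∨ 3 ≤ t ∧ 3 ≤ b) :
    0 < cnlExcess t b 2 := by
  rcases h with ⟨ht, hb⟩ | ⟨ht, hb⟩ | ⟨ht, hb⟩ <;>
  · obtain ⟨x, hx, rfl⟩ := exists_nonneg_add_of_le ht
    obtain ⟨y, hy, rfl⟩ := exists_nonneg_add_of_le hb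
    rw [cnlExcess, cnslExcess]
    ring_nf
    positivity

theorem cnslExcess_two_pos (h : 9 ≤ t ∧ 1 ≤ b ∨ 4 ≤ t ∧ 2 ≤ b ∨ 3 ≤ t ∧ 3 ≤ b) :
    0 < cnslExcess t b 2 := by
  rcases h with ⟨ht, hb⟩ | ⟨ht, hb⟩ | ⟨ht, hb⟩ <;>
  · obtain ⟨x, hx, rfl⟩ := exists_nonneg_add_of_le ht
    obtain ⟨y, hy, rfl⟩ := exists_nonneg_add_of_le hb
    rw [cnslExcess]
    ring_nf
    positivity

theorem cnlExcess_one_pos_iff {t b : ℕ} (ht : 2 ≤ t) (hb : 1 ≤ b) :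
    0 < cnlExcess t b 1 ↔ ¬ (t ≤ 5 ∧ b = 1 ∨ t = 2 ∧ b ≤ 3) := by
  refine ⟨fun pos exceptional => ?_, fun h => ?_⟩
  · rcases exceptional with ⟨ht', rfl⟩ | ⟨rfl, hb'⟩
    · interval_cases t <;> norm_num [cnlExcess, cnslExcess] at pos
    · interval_cases b <;> norm_num [cnlExcess, cnslExcess] at pos
  · have large : 6 ≤ t ∧ 1 ≤ b ∨ 3 ≤ t ∧ 2 ≤ b ∨ 2 ≤ t ∧ 4 ≤ b := by omega
    exact cnlExcess_one_pos (mod_cast large)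

theorem cnlExcess_one_eq_zero_iff {t b : ℕ} (ht : 2 ≤ t) (hb : 1 ≤ b) :
    cnlExcess t b 1 = 0 ↔ t = 5 ∧ b = 1 := by
  refine ⟨fun h => ?_, ?_⟩
  · rcases not_not.1 (mt (cnlExcess_one_pos_iff ht hb).2 h.not_gt) with ⟨ht', rfl⟩ | ⟨rfl, hb'⟩
    · refine ⟨by_contra fun ht5 => ?_, rfl⟩
      have ht4 : t ≤ 4 := by omega
      interval_cases t <;> norm_num [cnlExcess, cnslExcess] at h
    · interval_cases b <;> norm_num [cnlExcess, cnslExcess] at h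
  · rintro ⟨rfl, rfl⟩
    norm_num [cnlExcess, cnslExcess]

theorem cnslExcess_one_pos_iff {t b : ℕ} (ht : 2 ≤ t) (hb : 2 ≤ b) :
    0 < cnslExcess t b 1 ↔ ¬ (t ≤ 4 ∧ b = 2 ∨ t = 2 ∧ b ≤ 4) := by
  refine ⟨fun pos exceptional => ?_, fun h => ?_⟩
  · rcases exceptional with ⟨ht', rfl⟩ | ⟨rfl, hb'⟩
    · interval_cases t <;> norm_num [cnslExcess] at pos
    · interval_cases b <;> norm_num [cnslExcess] at pos
  · have large : 5 ≤ t ∧ 2 ≤ b ∨ 3 ≤ t ∧ 3 ≤ b ∨ 2 ≤ t ∧ 5 ≤ b := by omega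
    exact cnslExcess_one_pos (mod_cast large)

theorem cnslExcess_one_ne_zero {t b : ℕ} (ht : 2 ≤ t) (hb : 2 ≤ b) : cnslExcess t b 1 ≠ 0 := by
  intro h
  rcases not_not.1 (mt (cnslExcess_one_pos_iff ht hb).2 h.not_gt) with ⟨ht', rfl⟩ | ⟨rfl, hb'⟩
  · interval_cases t <;> norm_num [cnslExcess] at h
  · interval_cases b <;> norm_num [cnslExcess] at h

theorem cnlExcess_two_pos_iff {t b : ℕ} (ht : 3 ≤ t) (hb : 1 ≤ b) :
    0 < cnlExcess t b 2 ↔ ¬ (t ≤ 5 ∧ b = 1 ∨ t = 3 ∧ b = 2) := by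
  refine ⟨fun pos exceptional => ?_, fun h => ?_⟩
  · rcases exceptional with ⟨ht', rfl⟩ | ⟨rfl, rfl⟩
    · interval_cases t <;> norm_num [cnlExcess, cnslExcess] at pos
    · norm_num [cnlExcess, cnslExcess] at pos
  · have large : 6 ≤ t ∧ 1 ≤ b ∨ 4 ≤ t ∧ 2 ≤ b ∨ 3 ≤ t ∧ 3 ≤ b := by omega
    exact cnlExcess_two_pos (mod_cast large)

theorem cnlExcess_two_ne_zero {t b : ℕ} (ht : 3 ≤ t) (hb : 1 ≤ b) : cnlExcess t b 2 ≠ 0 := by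
  intro h
  rcases not_not.1 (mt (cnlExcess_two_pos_iff ht hb).2 h.not_gt) with ⟨ht', rfl⟩ | ⟨rfl, rfl⟩
  · interval_cases t <;> norm_num [cnlExcess, cnslExcess] at h
  · norm_num [cnlExcess, cnslExcess] at h

theorem cnslExcess_two_pos_iff {t b : ℕ} (ht : 3 ≤ t) (hb : 1 ≤ b) :
    0 < cnslExcess t b 2 ↔ ¬ (t ≤ 8 ∧ b = 1 ∨ t = 3 ∧ b = 2) := by
  refine ⟨fun pos exceptional => ?_, fun h => ?_⟩
  · rcases exceptional with ⟨ht', rfl⟩ | ⟨rfl, rfl⟩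
    · interval_cases t <;> norm_num [cnslExcess] at pos
    · norm_num [cnslExcess] at pos
  · have large : 9 ≤ t ∧ 1 ≤ b ∨ 4 ≤ t ∧ 2 ≤ b ∨ 3 ≤ t ∧ 3 ≤ b := by omega
    exact cnslExcess_two_pos (mod_cast large)

theorem cnslExcess_two_ne_zero {t b : ℕ} (ht : 3 ≤ t) (hb : 1 ≤ b) : cnslExcess t b 2 ≠ 0 := by
  intro h
  rcases not_not.1 (mt (cnslExcess_two_pos_iff ht hb).2 h.not_gt) with ⟨ht', rfl⟩ | ⟨rfl, rfl⟩
  · interval_cases t <;> norm_num [cnslExcess] at h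
  · norm_num [cnslExcess] at h

end ExcessSigns

/-- The orders of the components of `K_{tb} ∪ |J| K_b`, the large one being labelled `none`. -/
def cliqueSizes {J : Type*} (t b : ℕ) : Option J → ℕ := fun k => k.elim (t * b) fun _ => b

theorem cliqueSizes_ne_zero {J : Type*} {t b : ℕ} (ht : t ≠ 0) (hb : b ≠ 0) (k : Option J) :
    cliqueSizes t b k ≠ 0 := by
  cases k
  exacts [mul_ne_zero ht hb, hb]

theorem cliqueSizes_one {J : Type*} (b : ℕ) : cliqueSizes (J := J) 1 b = fun _ => b := by
  ext (_ | _)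
  exacts [one_mul b, rfl]

theorem sum_cliqueEnergy_cliqueSizes {J : Type*} [Fintype J] (t b : ℕ) (ε Δ : ℝ) :
    ∑ k : Option J, cliqueEnergy ε Δ (cliqueSizes t b k) =
      cliqueEnergy ε Δ (t * b) + Fintype.card J * cliqueEnergy ε Δ b := by
  simp only [Fintype.sum_option, cliqueSizes, Option.elim_none, Option.elim_some, Nat.cast_mul,
    Finset.sum_const, Finset.card_univ, nsmul_eq_mul]

namespace IsCliqueUnion

section CliqueSizes

variable {V J : Type*} [Fintype V] [Fintype J] {Γ : SimpleGraph V} {f : V → Option J} {t b : ℕ}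

theorem card_eq_add_mul (H : IsCliqueUnion Γ f (cliqueSizes t b)) :
    (Fintype.card V : ℝ) = (t + Fintype.card J) * b := by
  rw [H.card_eq, Fintype.sum_option]
  simp only [cliqueSizes, Option.elim_none, Option.elim_some, Nat.cast_mul, Finset.sum_const,
    Finset.card_univ, nsmul_eq_mul]
  ring

theorem cnDelta_eq_meanRowSum (H : IsCliqueUnion Γ f (cliqueSizes t b)) (hb : b ≠ 0) :
    Γ.cnDelta = meanRowSum t b (Fintype.card J) := by
  rw [H.cnDelta_eq, Fintype.sum_option, Fintype.sum_option]
  simp only [cliqueSizes, Option.elim_none, Option.elim_some, Nat.cast_mul, Finset.sum_const,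
    Finset.card_univ, nsmul_eq_mul]
  refine Eq.trans ?_ (mul_div_mul_left _ _ (Nat.cast_ne_zero.2 hb))
  congr 1 <;> ring

theorem cnlEnergy_eq_cnlExcess (H : IsCliqueUnion Γ f (cliqueSizes t b)) (ht : 2 ≤ t) (hb : 1 ≤ b)
    (hJ : 0 < Fintype.card J) (hJt : Fintype.card J ≤ t) :
    Γ.cnlEnergy = 2 * ((Fintype.card V : ℝ) - 1) * ((Fintype.card V : ℝ) - 2) +
      2 * cnlExcess t b (Fintype.card J) / (t + Fintype.card J) := by
  rw [H.cnlEnergy_eq (cliqueSizes_ne_zero (by omega) (by omega)),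
    H.cnDelta_eq_meanRowSum (by omega), H.card_eq_add_mul, sum_cliqueEnergy_cliqueSizes,
    cliqueEnergy_neg_one_add (mod_cast ht) (mod_cast hb) (mod_cast hJ) (mod_cast hJt)]

theorem cnslEnergy_eq_cnslExcess (H : IsCliqueUnion Γ f (cliqueSizes t b)) (ht : 2 ≤ t)
    (hb : 1 ≤ b) (hJ : 0 < Fintype.card J) (hJt : Fintype.card J ≤ t)
    (h : 2 ≤ b ∨ t ≤ Fintype.card J * (t - 2)) :
    Γ.cnslEnergy = 2 * ((Fintype.card V : ℝ) - 1) * ((Fintype.card V : ℝ) - 2) +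
      2 * cnslExcess t b (Fintype.card J) / (t + Fintype.card J) := by
  have hb' : (b : ℝ) = 1 ∨ 2 ≤ (b : ℝ) := mod_cast (by omega : b = 1 ∨ 2 ≤ b)
  have mean_le_sq : meanRowSum t b (Fintype.card J) ≤ ((t * b : ℝ) - 2) ^ 2 := by
    rcases hb' with hb1 | hb2
    · have h := h.resolve_left (by rw [Nat.cast_eq_one.1 hb1]; omega)
      rw [hb1]
      refine meanRowSum_one_le_sq (mod_cast ht) (mod_cast hJ) ?_
      rw [← Nat.cast_ofNat, ← Nat.cast_sub ht]
      exact mod_cast h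
    · exact meanRowSum_le_sq (mod_cast ht) hb2 (mod_cast hJ)
  rw [H.cnslEnergy_eq (cliqueSizes_ne_zero (by omega) (by omega)),
    H.cnDelta_eq_meanRowSum (by omega), H.card_eq_add_mul, sum_cliqueEnergy_cliqueSizes,
    cliqueEnergy_one_add (mod_cast ht) hb' (mod_cast hJ) (mod_cast hJt) mean_le_sq]

theorem cnslEnergy_lt (H : IsCliqueUnion Γ f (cliqueSizes t 1)) (ht : 2 ≤ t)
    (hJ : 0 < Fintype.card J) (h : Fintype.card J * (t - 2) ≤ t) :
    Γ.cnslEnergy < 2 * ((Fintype.card V : ℝ) - 1) * ((Fintype.card V : ℝ) - 2) := by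
  have h' : (Fintype.card J : ℝ) * (t - 2) ≤ t := by
    rw [← Nat.cast_ofNat, ← Nat.cast_sub ht]
    exact mod_cast h
  rw [H.cnslEnergy_eq (cliqueSizes_ne_zero (by omega) one_ne_zero),
    H.cnDelta_eq_meanRowSum one_ne_zero, H.card_eq_add_mul, sum_cliqueEnergy_cliqueSizes]
  simpa only [Nat.cast_one, mul_one] using
    cliqueEnergy_one_add_lt (mod_cast ht) (mod_cast hJ) h'

theorem cnlBorderenergetic_iff_cnlExcess (H : IsCliqueUnion Γ f (cliqueSizes t b)) (ht : 2 ≤ t)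
    (hb : 1 ≤ b) (hJ : 0 < Fintype.card J) (hJt : Fintype.card J ≤ t) :
    Γ.CNLBorderenergetic ↔ cnlExcess t b (Fintype.card J) = 0 := by
  have pos : (0 : ℝ) < t + Fintype.card J := by positivity
  rw [SimpleGraph.CNLBorderenergetic, H.cnlEnergy_eq_cnlExcess ht hb hJ hJt, add_eq_left,
    div_eq_zero_iff, or_iff_left pos.ne', mul_eq_zero_iff_left two_ne_zero]

theorem cnlHyperenergetic_iff_cnlExcess (H : IsCliqueUnion Γ f (cliqueSizes t b)) (ht : 2 ≤ t)
    (hb : 1 ≤ b) (hJ : 0 < Fintype.card J) (hJt : Fintype.card J ≤ t) :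
    Γ.CNLHyperenergetic ↔ 0 < cnlExcess t b (Fintype.card J) := by
  have pos : (0 : ℝ) < t + Fintype.card J := by positivity
  rw [SimpleGraph.CNLHyperenergetic, H.cnlEnergy_eq_cnlExcess ht hb hJ hJt, gt_iff_lt,
    lt_add_iff_pos_right, div_pos_iff_of_pos_right pos, mul_pos_iff_of_pos_left two_pos]

theorem cnslBorderenergetic_iff_cnslExcess (H : IsCliqueUnion Γ f (cliqueSizes t b)) (ht : 2 ≤ t)
    (hb : 1 ≤ b) (hJ : 0 < Fintype.card J) (hJt : Fintype.card J ≤ t)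
    (h : 2 ≤ b ∨ t ≤ Fintype.card J * (t - 2)) :
    Γ.CNSLBorderenergetic ↔ cnslExcess t b (Fintype.card J) = 0 := by
  have pos : (0 : ℝ) < t + Fintype.card J := by positivity
  rw [SimpleGraph.CNSLBorderenergetic, H.cnslEnergy_eq_cnslExcess ht hb hJ hJt h, add_eq_left,
    div_eq_zero_iff, or_iff_left pos.ne', mul_eq_zero_iff_left two_ne_zero]

theorem cnslHyperenergetic_iff_cnslExcess (H : IsCliqueUnion Γ f (cliqueSizes t b)) (ht : 2 ≤ t)
    (hb : 1 ≤ b) (hJ : 0 < Fintype.card J) (hJt : Fintype.card J ≤ t)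
    (h : 2 ≤ b ∨ t ≤ Fintype.card J * (t - 2)) :
    Γ.CNSLHyperenergetic ↔ 0 < cnslExcess t b (Fintype.card J) := by
  have pos : (0 : ℝ) < t + Fintype.card J := by positivity
  rw [SimpleGraph.CNSLHyperenergetic, H.cnslEnergy_eq_cnslExcess ht hb hJ hJt h, gt_iff_lt,
    lt_add_iff_pos_right, div_pos_iff_of_pos_right pos, mul_pos_iff_of_pos_left two_pos]

theorem cnlBorderenergetic_iff_of_card_eq_one (H : IsCliqueUnion Γ f (cliqueSizes t b))
    (hJ : Fintype.card J = 1) (ht : 2 ≤ t) (hb : 1 ≤ b) :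
    Γ.CNLBorderenergetic ↔ t = 5 ∧ b = 1 := by
  rw [H.cnlBorderenergetic_iff_cnlExcess ht hb (by omega) (by omega), hJ, Nat.cast_one,
    cnlExcess_one_eq_zero_iff ht hb]

theorem cnlHyperenergetic_iff_of_card_eq_one (H : IsCliqueUnion Γ f (cliqueSizes t b))
    (hJ : Fintype.card J = 1) (ht : 2 ≤ t) (hb : 1 ≤ b) :
    Γ.CNLHyperenergetic ↔ ¬ (t ≤ 5 ∧ b = 1 ∨ t = 2 ∧ b ≤ 3) := by
  rw [H.cnlHyperenergetic_iff_cnlExcess ht hb (by omega) (by omega), hJ, Nat.cast_one,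
    cnlExcess_one_pos_iff ht hb]

theorem not_cnslBorderenergetic_of_card_eq_one (H : IsCliqueUnion Γ f (cliqueSizes t b))
    (hJ : Fintype.card J = 1) (ht : 2 ≤ t) (hb : 1 ≤ b) : ¬ Γ.CNSLBorderenergetic := by
  obtain rfl | hb2 : b = 1 ∨ 2 ≤ b := by omega
  · exact (H.cnslEnergy_lt ht (by omega) (by rw [hJ]; omega)).ne
  · rw [H.cnslBorderenergetic_iff_cnslExcess ht hb (by omega) (by omega) (Or.inl hb2), hJ,
      Nat.cast_one]
    exact cnslExcess_one_ne_zero ht hb2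

theorem cnslHyperenergetic_iff_of_card_eq_one (H : IsCliqueUnion Γ f (cliqueSizes t b))
    (hJ : Fintype.card J = 1) (ht : 2 ≤ t) (hb : 1 ≤ b) :
    Γ.CNSLHyperenergetic ↔ ¬ (b = 1 ∨ t ≤ 4 ∧ b = 2 ∨ t = 2 ∧ b ≤ 4) := by
  obtain rfl | hb2 : b = 1 ∨ 2 ≤ b := by omega
  · have lt := H.cnslEnergy_lt ht (by omega) (by rw [hJ]; omega)
    exact iff_of_false lt.not_gt (by omega)
  · rw [H.cnslHyperenergetic_iff_cnslExcess ht hb (by omega) (by omega) (Or.inl hb2), hJ,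
      Nat.cast_one, cnslExcess_one_pos_iff ht hb2, or_iff_right (by omega : b ≠ 1)]

theorem not_cnlBorderenergetic_of_card_eq_two (H : IsCliqueUnion Γ f (cliqueSizes t b))
    (hJ : Fintype.card J = 2) (ht : 3 ≤ t) (hb : 1 ≤ b) : ¬ Γ.CNLBorderenergetic := by
  rw [H.cnlBorderenergetic_iff_cnlExcess (by omega) hb (by omega) (by omega), hJ, Nat.cast_ofNat]
  exact cnlExcess_two_ne_zero ht hb

theorem cnlHyperenergetic_iff_of_card_eq_two (H : IsCliqueUnion Γ f (cliqueSizes t b))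
    (hJ : Fintype.card J = 2) (ht : 3 ≤ t) (hb : 1 ≤ b) :
    Γ.CNLHyperenergetic ↔ ¬ (t ≤ 5 ∧ b = 1 ∨ t = 3 ∧ b = 2) := by
  rw [H.cnlHyperenergetic_iff_cnlExcess (by omega) hb (by omega) (by omega), hJ, Nat.cast_ofNat,
    cnlExcess_two_pos_iff ht hb]

theorem not_cnslBorderenergetic_of_card_eq_two (H : IsCliqueUnion Γ f (cliqueSizes t b))
    (hJ : Fintype.card J = 2) (ht : 3 ≤ t) (hb : 1 ≤ b) : ¬ Γ.CNSLBorderenergetic := by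
  by_cases smallest : t = 3 ∧ b = 1
  · obtain ⟨rfl, rfl⟩ := smallest
    exact (H.cnslEnergy_lt (by omega) (by omega) (by omega)).ne
  · rw [H.cnslBorderenergetic_iff_cnslExcess (by omega) hb (by omega) (by omega)
      (by rw [hJ]; omega), hJ, Nat.cast_ofNat]
    exact cnslExcess_two_ne_zero ht hb

theorem cnslHyperenergetic_iff_of_card_eq_two (H : IsCliqueUnion Γ f (cliqueSizes t b))
    (hJ : Fintype.card J = 2) (ht : 3 ≤ t) (hb : 1 ≤ b) :
    Γ.CNSLHyperenergetic ↔ ¬ (t ≤ 8 ∧ b = 1 ∨ t = 3 ∧ b = 2) := by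
  by_cases smallest : t = 3 ∧ b = 1
  · obtain ⟨rfl, rfl⟩ := smallest
    have lt := H.cnslEnergy_lt (by omega) (by omega) (by omega)
    exact iff_of_false lt.not_gt (by omega)
  · rw [H.cnslHyperenergetic_iff_cnslExcess (by omega) hb (by omega) (by omega)
      (by rw [hJ]; omega), hJ, Nat.cast_ofNat, cnslExcess_two_pos_iff ht hb]

end CliqueSizes

section EqualSizes

variable {V I : Type*} [Fintype V] [Fintype I] {Γ : SimpleGraph V} {f : V → I} {b : ℕ}

theorem cnDelta_eq_of_const (H : IsCliqueUnion Γ f fun _ => b) (hI : Fintype.card I ≠ 0)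
    (hb : b ≠ 0) : Γ.cnDelta = ((b : ℝ) - 1) * (b - 2) := by
  rw [H.cnDelta_eq, ← Finset.sum_mul, mul_div_cancel_left₀]
  simp [hI, hb]

theorem sum_cliqueEnergy_of_const (H : IsCliqueUnion Γ f fun _ => b) (hI : Fintype.card I ≠ 0)
    (hb : b ≠ 0) {ε : ℝ} (hε : |ε| = 1) :
    ∑ _i : I, cliqueEnergy ε Γ.cnDelta b = 2 * Fintype.card I * ((b - 1) * (b - 2)) := by
  have row_sum_nonneg : 0 ≤ ((b : ℝ) - 1) * (b - 2) := by
    obtain rfl | hb2 : b = 1 ∨ 2 ≤ b := by omega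
    · norm_num
    · have : (2 : ℝ) ≤ b := mod_cast hb2
      nlinarith
  rw [H.cnDelta_eq_of_const hI hb, cliqueEnergy_self hε (mod_cast Nat.one_le_iff_ne_zero.2 hb)
    row_sum_nonneg, Finset.sum_const, Finset.card_univ, nsmul_eq_mul]
  ring

theorem cnlEnergy_eq_of_const (H : IsCliqueUnion Γ f fun _ => b) (hI : Fintype.card I ≠ 0)
    (hb : b ≠ 0) : Γ.cnlEnergy = 2 * Fintype.card I * ((b - 1) * (b - 2)) := by
  rw [H.cnlEnergy_eq fun _ => hb, H.sum_cliqueEnergy_of_const hI hb (by norm_num)]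

theorem cnslEnergy_eq_cnlEnergy_of_const (H : IsCliqueUnion Γ f fun _ => b)
    (hI : Fintype.card I ≠ 0) (hb : b ≠ 0) : Γ.cnslEnergy = Γ.cnlEnergy := by
  rw [H.cnlEnergy_eq_of_const hI hb, H.cnslEnergy_eq fun _ => hb,
    H.sum_cliqueEnergy_of_const hI hb (by norm_num)]

theorem bound_eq_cnlEnergy_add_of_const (H : IsCliqueUnion Γ f fun _ => b)
    (hI : Fintype.card I = 2) (hb : b ≠ 0) :
    2 * ((Fintype.card V : ℝ) - 1) * ((Fintype.card V : ℝ) - 2) =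
      Γ.cnlEnergy + 4 * ((b : ℝ) ^ 2 - 1) := by
  rw [H.cnlEnergy_eq_of_const (by omega) hb, H.card_eq, Finset.sum_const, Finset.card_univ,
    nsmul_eq_mul, hI]
  push_cast
  ring

theorem cnlBorderenergetic_iff_of_const (H : IsCliqueUnion Γ f fun _ => b)
    (hI : Fintype.card I = 2) (hb : b ≠ 0) : Γ.CNLBorderenergetic ↔ b = 1 := by
  rw [SimpleGraph.CNLBorderenergetic, H.bound_eq_cnlEnergy_add_of_const hI hb, left_eq_add,
    mul_eq_zero_iff_left four_ne_zero, sub_eq_zero,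
    pow_eq_one_iff_of_nonneg b.cast_nonneg two_ne_zero, Nat.cast_eq_one]

theorem not_cnlHyperenergetic_of_const (H : IsCliqueUnion Γ f fun _ => b)
    (hI : Fintype.card I = 2) (hb : b ≠ 0) : ¬ Γ.CNLHyperenergetic := by
  have one_le_sq : 1 ≤ (b : ℝ) ^ 2 := one_le_pow₀ (mod_cast Nat.one_le_iff_ne_zero.2 hb)
  rw [SimpleGraph.CNLHyperenergetic, H.bound_eq_cnlEnergy_add_of_const hI hb]
  linarith

theorem cnslBorderenergetic_iff_of_const (H : IsCliqueUnion Γ f fun _ => b)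
    (hI : Fintype.card I = 2) (hb : b ≠ 0) : Γ.CNSLBorderenergetic ↔ b = 1 := by
  rw [SimpleGraph.CNSLBorderenergetic, H.cnslEnergy_eq_cnlEnergy_of_const (by omega) hb]
  exact H.cnlBorderenergetic_iff_of_const hI hb

theorem not_cnslHyperenergetic_of_const (H : IsCliqueUnion Γ f fun _ => b)
    (hI : Fintype.card I = 2) (hb : b ≠ 0) : ¬ Γ.CNSLHyperenergetic := by
  rw [SimpleGraph.CNSLHyperenergetic, H.cnslEnergy_eq_cnlEnergy_of_const (by omega) hb]
  exact H.not_cnlHyperenergetic_of_const hI hb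

end EqualSizes

end IsCliqueUnion

section Counting

theorem ncard_preimage_eq_mul_ncard {α β : Type*} [Finite α] [Finite β] {f : α → β} {t : Set β}
    {k : ℕ} (h : ∀ b ∈ t, (f ⁻¹' {b}).ncard = k) : (f ⁻¹' t).ncard = k * t.ncard := by
  classical
  have := Fintype.ofFinite α
  have := Fintype.ofFinite β
  have maps_to : Set.MapsTo f ((f ⁻¹' t).toFinset : Set α) (t.toFinset : Set β) :=
    fun a ha => by simpa using ha
  rw [Set.ncard_eq_toFinset_card', Set.ncard_eq_toFinset_card',
    Finset.card_eq_sum_card_fiberwise maps_to, mul_comm, ← smul_eq_mul, ← Finset.sum_const]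
  refine Finset.sum_congr rfl fun b hb => ?_
  rw [Set.mem_toFinset] at hb
  rw [← h b hb, Set.ncard_eq_toFinset_card']
  congr 1
  ext a
  simp only [Finset.mem_filter, Set.mem_toFinset, Set.mem_preimage, Set.mem_singleton_iff]
  exact and_iff_right_of_imp fun ha => ha ▸ hb

@[to_additive]
theorem ncard_preimage_monoidHom {G H : Type*} [Group G] [Group H] [Finite G] {φ : G →* H}
    (hφ : Function.Surjective φ) (s : Set H) : (φ ⁻¹' s).ncard = Nat.card φ.ker * s.ncard := by
  have : Finite H := .of_surjective φ hφ
  exact ncard_preimage_eq_mul_ncard fun b _ => Nat.card_congr (φ.fiberEquivKerOfSurjective hφ b)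

@[to_additive]
theorem card_ker_mul_card {G H : Type*} [Group G] [Group H] {φ : G →* H}
    (hφ : Function.Surjective φ) : Nat.card φ.ker * Nat.card H = Nat.card G := by
  rw [← φ.ker.card_mul_index, φ.ker.index_eq_card]
  exact congrArg _ (Nat.card_congr (QuotientGroup.quotientKerEquivOfSurjective φ hφ).symm.toEquiv)

theorem ncard_carrier_mul_card_centralizer {G : Type*} [Group G] (x : G) :
    (ConjClasses.mk x).carrier.ncard * Nat.card (Subgroup.centralizer {x}) = Nat.card G := by
  rw [Subgroup.nat_card_centralizer_nat_card_stabilizer, ← ConjAct.orbit_eq_carrier_conjClasses,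
    ← MulAction.index_stabilizer]
  exact Subgroup.index_mul_card _

end Counting

section DihedralGroup

open DihedralGroup

variable {n : ℕ}

/-- The kind of a rotation is `none`, and the kind of a reflection `sr i` is `i` modulo `gcd n 2`:
there is one kind of reflections if `n` is odd, and there are two if `n` is even. When
`G ⧸ center G ≃* DihedralGroup n`, two noncentral classes of `G` are adjacent in the CCC-graph
exactly if their images have the same kind. -/
def kind : DihedralGroup n → Option (ZMod (n.gcd 2))
  | r _ => none
  | sr i => some (ZMod.castHom (n.gcd_dvd_left 2) _ i)

theorem add_self_eq_zero_zmod_gcd_two (c : ZMod (n.gcd 2)) : c + c = 0 := by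
  have two_eq_zero : ((2 : ℕ) : ZMod (n.gcd 2)) = 0 :=
    (ZMod.natCast_eq_zero_iff _ _).2 (n.gcd_dvd_right 2)
  linear_combination c * two_eq_zero

theorem exists_add_self_of_castHom_eq_zero {i : ZMod n}
    (h : ZMod.castHom (n.gcd_dvd_left 2) (ZMod (n.gcd 2)) i = 0) : ∃ c, i = c + c := by
  obtain ⟨k, rfl⟩ := ZMod.intCast_surjective i
  rw [map_intCast, ZMod.intCast_zmod_eq_zero_iff_dvd] at h
  obtain ⟨l, rfl⟩ := h
  refine ⟨((n.gcdB 2 * l : ℤ) : ZMod n), ?_⟩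
  rw [Nat.gcd_eq_gcd_ab]
  push_cast
  rw [ZMod.natCast_self]
  ring

theorem kind_conj (g x : DihedralGroup n) : kind (g * x * g⁻¹) = kind x := by
  rcases g with a | a <;> rcases x with _ | b <;>
    simp only [r_mul_r, r_mul_sr, sr_mul_r, sr_mul_sr, inv_r, inv_sr, kind, map_add, map_sub,
      map_neg, Option.some.injEq]
  · linear_combination -add_self_eq_zero_zmod_gcd_two (ZMod.castHom _ _ a)
  · linear_combination add_self_eq_zero_zmod_gcd_two (ZMod.castHom _ _ a) -
      add_self_eq_zero_zmod_gcd_two (ZMod.castHom _ _ b)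

theorem isConj_sr_of_kind_eq {i j : ZMod n} (h : kind (sr i) = kind (sr j)) :
    IsConj (sr i) (sr j) := by
  obtain ⟨c, hc⟩ := exists_add_self_of_castHom_eq_zero (i := i - j) <| by
    rw [map_sub, sub_eq_zero]
    exact Option.some.inj h
  refine isConj_iff.2 ⟨r c, ?_⟩
  rw [r_mul_sr, inv_r, sr_mul_r, sr.injEq]
  linear_combination hc

theorem ncard_setOf_kind_eq_none : {x : DihedralGroup n | kind x = none}.ncard = n := by
  have h : {x : DihedralGroup n | kind x = none} = Set.range r := by
    ext (i | i) <;> simp [kind]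
  rw [h, ← Set.image_univ, Set.ncard_image_of_injective _ fun _ _ => r.inj, Set.ncard_univ,
    Nat.card_zmod]

theorem gcd_two_mul_ncard_setOf_kind_eq_some [NeZero n] (c : ZMod (n.gcd 2)) :
    n.gcd 2 * {x : DihedralGroup n | kind x = some c}.ncard = n := by
  have hf := ZMod.castHom_surjective (n.gcd_dvd_left 2)
  let f := (ZMod.castHom (n.gcd_dvd_left 2) (ZMod (n.gcd 2))).toAddMonoidHom
  have h : {x : DihedralGroup n | kind x = some c} = sr '' (f ⁻¹' {c}) := by
    ext (i | i) <;> simp [kind, f]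
  have hcard := card_ker_add_card (φ := f) hf
  rw [Nat.card_zmod, Nat.card_zmod] at hcard
  rw [h, Set.ncard_image_of_injective _ fun _ _ => sr.inj, ncard_preimage_addMonoidHom hf,
    Set.ncard_singleton, mul_one, mul_comm, hcard]

theorem sr_ne_one (i : ZMod n) : sr i ≠ (1 : DihedralGroup n) := by
  simp [one_def, -r_zero]

end DihedralGroup

section CentralQuotient

variable {G H : Type*} [Group G] [Group H]

theorem commute_of_map_mem_zpowers {φ : G →* H} (hk : φ.ker ≤ Subgroup.center G) {a x y : G}
    (hx : φ x ∈ Subgroup.zpowers (φ a)) (hy : φ y ∈ Subgroup.zpowers (φ a)) : Commute x y := by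
  have exists_eq_zpow_mul {w : G} (hw : φ w ∈ Subgroup.zpowers (φ a)) :
      ∃ (l : ℤ), ∃ c ∈ Subgroup.center G, w = a ^ l * c := by
    obtain ⟨l, hl⟩ := Subgroup.mem_zpowers_iff.1 hw
    refine ⟨l, (a ^ l)⁻¹ * w, hk ?_, by group⟩
    rw [MonoidHom.mem_ker, map_mul, map_inv, map_zpow, hl, inv_mul_cancel]
  obtain ⟨k, c, hc, rfl⟩ := exists_eq_zpow_mul hx
  obtain ⟨l, d, hd, rfl⟩ := exists_eq_zpow_mul hy
  have commute_c (g : G) : Commute c g := (Subgroup.mem_center_iff.1 hc g).symm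
  have commute_d (g : G) : Commute g d := Subgroup.mem_center_iff.1 hd g
  exact (((Commute.refl a).zpow_zpow k l).mul_right (commute_d _)).mul_left (commute_c _)

theorem commute_of_map_eq {φ : G →* H} (hk : φ.ker ≤ Subgroup.center G) {x y : G}
    (h : φ x = φ y) : Commute x y :=
  commute_of_map_mem_zpowers hk (h ▸ Subgroup.mem_zpowers _) (Subgroup.mem_zpowers _)

theorem ncard_carrier_mul_ncard [Finite G] {φ : G →* H} (hφ : Function.Surjective φ) {x : G}
    {s : Set H} (hs : (Subgroup.centralizer {x} : Set G) = φ ⁻¹' s) :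
    (ConjClasses.mk x).carrier.ncard * s.ncard = Nat.card H := by
  have h := ncard_carrier_mul_card_centralizer x
  rw [← SetLike.coe_sort_coe, hs, Nat.card_coe_set_eq, ncard_preimage_monoidHom hφ,
    ← card_ker_mul_card hφ, mul_left_comm] at h
  exact Nat.eq_of_mul_eq_mul_left Nat.card_pos h

end CentralQuotient

section DihedralQuotient

open DihedralGroup

variable {G : Type*} [Group G] {n : ℕ} {φ : G →* DihedralGroup n}

theorem commute_of_map_eq_r (hφ : Function.Surjective φ) (hk : φ.ker ≤ Subgroup.center G)
    {x y : G} {i j : ZMod n} (hx : φ x = r i) (hy : φ y = r j) : Commute x y := by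
  obtain ⟨a, ha⟩ := hφ (r 1)
  have r_mem_zpowers (i : ZMod n) : r i ∈ Subgroup.zpowers (φ a) := by
    obtain ⟨l, rfl⟩ := ZMod.intCast_surjective i
    exact ⟨l, by simp only [ha, r_one_zpow]⟩
  exact commute_of_map_mem_zpowers hk (hx ▸ r_mem_zpowers i) (hy ▸ r_mem_zpowers j)

theorem map_eq_one_of_commute (hφ : Function.Surjective φ) (hk : φ.ker = Subgroup.center G)
    {x y : G} {i j : ZMod n} (hx : φ x = r i) (hy : φ y = sr j) (h : Commute x y) : φ x = 1 := by
  -- `x` commutes with `y` and with every lift of a rotation, and these generate `G`.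
  rw [← MonoidHom.mem_ker, hk, Subgroup.mem_center_iff]
  intro g
  rcases hg : φ g with l | l
  · exact commute_of_map_eq_r hφ hk.le hg hx
  · have hgy : φ (g * y) = r (j - l) := by rw [map_mul, hg, hy, sr_mul_sr]
    have commute_gy : Commute x (g * y) := commute_of_map_eq_r hφ hk.le hx hgy
    simpa using (commute_gy.mul_right h.inv_right).symm.eq

theorem centralizer_eq_preimage_of_map_eq_r (hφ : Function.Surjective φ)
    (hk : φ.ker = Subgroup.center G) {x : G} {i : ZMod n} (hx : φ x = r i) (hx1 : φ x ≠ 1) :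
    (Subgroup.centralizer {x} : Set G) = φ ⁻¹' {d | kind d = none} := by
  ext y
  rw [SetLike.mem_coe, Subgroup.mem_centralizer_singleton_iff, Set.mem_preimage, Set.mem_ofPred_eq]
  rcases hy : φ y with j | j
  · exact iff_of_true (commute_of_map_eq_r hφ hk.le hy hx) rfl
  · exact iff_of_false (fun h => hx1 (map_eq_one_of_commute hφ hk hx hy h.symm))
      (Option.some_ne_none _)

theorem centralizer_eq_preimage_of_map_eq_sr (hφ : Function.Surjective φ)
    (hk : φ.ker = Subgroup.center G) {x : G} {i : ZMod n} (hx : φ x = sr i) :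
    (Subgroup.centralizer {x} : Set G) = φ ⁻¹' {1, sr i} := by
  ext y
  rw [SetLike.mem_coe, Subgroup.mem_centralizer_singleton_iff, Set.mem_preimage,
    Set.mem_insert_iff, Set.mem_singleton_iff]
  constructor
  · intro h
    rcases hy : φ y with j | j
    · exact Or.inl (hy ▸ map_eq_one_of_commute hφ hk hy hx h)
    · have hxy : φ (x * y) = r (j - i) := by rw [map_mul, hx, hy, sr_mul_sr]
      have hxy1 := map_eq_one_of_commute hφ hk hxy hx ((Commute.refl x).mul_left h)
      rw [hxy, one_def, r.injEq, sub_eq_zero] at hxy1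
      exact Or.inr (by rw [hxy1])
  · rintro (h | h)
    · have hy : y ∈ Subgroup.center G := hk ▸ MonoidHom.mem_ker.2 h
      exact (Subgroup.mem_center_iff.1 hy x).symm
    · exact commute_of_map_eq hk.le (h.trans hx.symm)

theorem ncard_carrier_of_kind_eq_none [Finite G] [NeZero n] (hφ : Function.Surjective φ)
    (hk : φ.ker = Subgroup.center G) {x : G} (hx1 : φ x ≠ 1) (hx : kind (φ x) = none) :
    (ConjClasses.mk x).carrier.ncard = 2 := by
  rcases hi : φ x with i | i
  · have h := ncard_carrier_mul_ncard hφ (centralizer_eq_preimage_of_map_eq_r hφ hk hi hx1)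
    rw [ncard_setOf_kind_eq_none, DihedralGroup.nat_card] at h
    exact Nat.eq_of_mul_eq_mul_right (NeZero.pos n) h
  · exact absurd (hi ▸ hx) (Option.some_ne_none _)

theorem ncard_carrier_of_kind_eq_some [Finite G] (hφ : Function.Surjective φ)
    (hk : φ.ker = Subgroup.center G) {x : G} {c : ZMod (n.gcd 2)} (hx : kind (φ x) = some c) :
    (ConjClasses.mk x).carrier.ncard = n := by
  rcases hi : φ x with i | i
  · exact absurd (hi ▸ hx).symm (Option.some_ne_none c)
  · have h := ncard_carrier_mul_ncard hφ (centralizer_eq_preimage_of_map_eq_sr hφ hk hi)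
    rw [Set.ncard_pair (sr_ne_one i).symm, DihedralGroup.nat_card, mul_comm] at h
    exact Nat.eq_of_mul_eq_mul_left two_pos h

theorem kind_map_eq_of_isConj {x y : G} (h : IsConj x y) : kind (φ x) = kind (φ y) := by
  obtain ⟨g, rfl⟩ := isConj_iff.1 h
  rw [map_mul, map_mul, map_inv, kind_conj]

theorem kind_map_eq_of_commute (hφ : Function.Surjective φ) (hk : φ.ker = Subgroup.center G)
    {x y : G} (hx1 : φ x ≠ 1) (hy1 : φ y ≠ 1) (h : Commute x y) : kind (φ x) = kind (φ y) := by
  have hy : y ∈ (Subgroup.centralizer {x} : Set G) :=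
    Subgroup.mem_centralizer_singleton_iff.2 h.symm
  rcases hi : φ x with i | i
  · rw [centralizer_eq_preimage_of_map_eq_r hφ hk hi hx1] at hy
    exact hy.symm
  · rw [centralizer_eq_preimage_of_map_eq_sr hφ hk hi] at hy
    rw [hy.resolve_left hy1]

theorem exists_isConj_commute_of_kind_map_eq (hφ : Function.Surjective φ)
    (hk : φ.ker ≤ Subgroup.center G) {x y : G} (h : kind (φ x) = kind (φ y)) :
    ∃ y', IsConj y y' ∧ Commute x y' := by
  rcases hi : φ x with i | i <;> rcases hj : φ y with j | j <;> rw [hi, hj] at h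
  · exact ⟨y, IsConj.refl y, commute_of_map_eq_r hφ hk hi hj⟩
  · exact absurd h.symm (Option.some_ne_none _)
  · exact absurd h (Option.some_ne_none _)
  · obtain ⟨g, hg⟩ := isConj_iff.1 (isConj_sr_of_kind_eq h.symm)
    obtain ⟨g, rfl⟩ := hφ g
    exact ⟨g * y * g⁻¹, isConj_iff.2 ⟨g, rfl⟩,
      commute_of_map_eq hk (by rw [map_mul, map_mul, map_inv, hj, hg, hi])⟩

end DihedralQuotient

section Vertices

open DihedralGroup

variable {G : Type*} [Group G] {n : ℕ} {φ : G →* DihedralGroup n}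

theorem notMem_center_of_mk_eq {v : Vertex G} {x : G} (h : ConjClasses.mk x = v.1) :
    x ∉ Subgroup.center G := by
  obtain ⟨y, hy, hyv⟩ := v.2
  obtain ⟨g, rfl⟩ := isConj_iff.1 (ConjClasses.mk_eq_mk_iff_isConj.1 (h.trans hyv.symm))
  exact fun hx => hy (Subgroup.Normal.conj_mem inferInstance x hx g)

/-- The kind of the image in the dihedral group of any representative of a noncentral class. -/
noncomputable def vertexKind (φ : G →* DihedralGroup n) (v : Vertex G) :
    Option (ZMod (n.gcd 2)) :=
  kind (φ (Quotient.out v.1))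

theorem vertexKind_eq {v : Vertex G} {x : G} (h : ConjClasses.mk x = v.1) :
    vertexKind φ v = kind (φ x) :=
  kind_map_eq_of_isConj (ConjClasses.mk_eq_mk_iff_isConj.1 ((Quotient.out_eq v.1).trans h.symm))

theorem graph_adj_iff (hφ : Function.Surjective φ) (hk : φ.ker = Subgroup.center G)
    (v w : Vertex G) : (graph G).Adj v w ↔ v ≠ w ∧ vertexKind φ v = vertexKind φ w := by
  refine and_congr_right fun _ => ⟨?_, fun h => ?_⟩
  · rintro ⟨x, y, hx, hy, hxy⟩
    have map_ne_one {z : G} (hz : z ∉ Subgroup.center G) : φ z ≠ 1 := by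
      rwa [← hk, MonoidHom.mem_ker] at hz
    rw [vertexKind_eq hx, vertexKind_eq hy]
    exact kind_map_eq_of_commute hφ hk (map_ne_one (notMem_center_of_mk_eq hx))
      (map_ne_one (notMem_center_of_mk_eq hy)) hxy
  · obtain ⟨x, -, hx⟩ := v.2
    obtain ⟨y, -, hy⟩ := w.2
    rw [vertexKind_eq hx, vertexKind_eq hy] at h
    obtain ⟨y', hyy', hxy'⟩ := exists_isConj_commute_of_kind_map_eq hφ hk.le h
    exact ⟨x, y', hx, (ConjClasses.mk_eq_mk_iff_isConj.2 hyy'.symm).trans hy, hxy'⟩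

theorem mk_preimage_vertexKind_fiber (hk : φ.ker = Subgroup.center G)
    (k : Option (ZMod (n.gcd 2))) :
    ConjClasses.mk ⁻¹' (Subtype.val '' {v : Vertex G | vertexKind φ v = k}) =
      φ ⁻¹' ({d | kind d = k} \ {1}) := by
  ext x
  have map_ne_one_iff : φ x ≠ 1 ↔ x ∉ Subgroup.center G := by rw [← hk, MonoidHom.mem_ker]
  constructor
  · rintro ⟨v, hv, hvx⟩
    exact ⟨(vertexKind_eq hvx.symm).symm.trans hv,
      map_ne_one_iff.2 (notMem_center_of_mk_eq hvx.symm)⟩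
  · rintro ⟨hx, hx1⟩
    exact ⟨⟨_, x, map_ne_one_iff.1 hx1, rfl⟩, (vertexKind_eq rfl).trans hx, rfl⟩

theorem mul_card_vertexKind_fiber [Finite G] (hφ : Function.Surjective φ)
    (hk : φ.ker = Subgroup.center G) {k : Option (ZMod (n.gcd 2))} {s : ℕ}
    (hs : ∀ x, φ x ≠ 1 → kind (φ x) = k → (ConjClasses.mk x).carrier.ncard = s) :
    s * Nat.card {v // vertexKind φ v = k} =
      Nat.card (Subgroup.center G) * ({d | kind d = k} \ {1} : Set (DihedralGroup n)).ncard := by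
  have hpre := mk_preimage_vertexKind_fiber hk k
  have : Finite (ConjClasses G) := .of_surjective _ ConjClasses.mk_surjective
  rw [← hk, ← ncard_preimage_monoidHom hφ, ← hpre, ncard_preimage_eq_mul_ncard (k := s),
    Set.ncard_image_of_injective _ Subtype.val_injective]
  · rfl
  · intro c hc
    obtain ⟨x, rfl⟩ := ConjClasses.mk_surjective c
    have hx : x ∈ φ ⁻¹' ({d | kind d = k} \ {1}) := hpre ▸ hc
    have mk_preimage : ConjClasses.mk ⁻¹' {ConjClasses.mk x} = (ConjClasses.mk x).carrier :=
      Set.ext fun _ => ConjClasses.mem_carrier_iff_mk_eq.symm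
    rw [mk_preimage, hs x hx.2 hx.1]

theorem two_mul_card_vertexKind_fiber_none [Finite G] [NeZero n] (hφ : Function.Surjective φ)
    (hk : φ.ker = Subgroup.center G) :
    2 * Nat.card {v // vertexKind φ v = none} = Nat.card (Subgroup.center G) * (n - 1) := by
  have kind_one : (1 : DihedralGroup n) ∈ {d | kind d = none} := rfl
  rw [mul_card_vertexKind_fiber hφ hk fun x => ncard_carrier_of_kind_eq_none hφ hk (x := x),
    Set.ncard_sdiff_singleton_of_mem kind_one, ncard_setOf_kind_eq_none]

theorem gcd_two_mul_card_vertexKind_fiber_some [Finite G] [NeZero n]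
    (hφ : Function.Surjective φ) (hk : φ.ker = Subgroup.center G) (c : ZMod (n.gcd 2)) :
    n.gcd 2 * Nat.card {v // vertexKind φ v = some c} = Nat.card (Subgroup.center G) := by
  have h := mul_card_vertexKind_fiber hφ hk fun x _ =>
    ncard_carrier_of_kind_eq_some hφ hk (x := x) (c := c)
  have kind_one : (1 : DihedralGroup n) ∉ {d | kind d = some c} := nofun
  rw [Set.sdiff_singleton_eq_self kind_one] at h
  refine Nat.eq_of_mul_eq_mul_left (NeZero.pos n) ?_
  rw [mul_left_comm, h, mul_left_comm, gcd_two_mul_ncard_setOf_kind_eq_some, mul_comm]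

theorem isCliqueUnion_graph [Finite G] [NeZero n] (hφ : Function.Surjective φ)
    (hk : φ.ker = Subgroup.center G) {t b : ℕ} (ht : 2 * t = n.gcd 2 * (n - 1))
    (hb : n.gcd 2 * b = Nat.card (Subgroup.center G)) :
    IsCliqueUnion (graph G) (vertexKind φ) (cliqueSizes t b) := by
  refine ⟨graph_adj_iff hφ hk, ?_⟩
  rintro (_ | c)
  · refine Nat.eq_of_mul_eq_mul_left two_pos ?_
    rw [two_mul_card_vertexKind_fiber_none hφ hk, ← hb, cliqueSizes, Option.elim_none,
      ← mul_assoc, ht]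
    ring
  · refine Nat.eq_of_mul_eq_mul_left (Nat.gcd_pos_of_pos_right n two_pos) ?_
    rw [gcd_two_mul_card_vertexKind_fiber_some hφ hk, ← hb]
    rfl

theorem exists_isCliqueUnion_graph [Finite G] [NeZero n]
    (e : G ⧸ Subgroup.center G ≃* DihedralGroup n) :
    ∃ (f : Vertex G → Option (ZMod (n.gcd 2))) (t b : ℕ), 2 * t = n.gcd 2 * (n - 1) ∧
      n.gcd 2 * b = Nat.card (Subgroup.center G) ∧
        IsCliqueUnion (graph G) f (cliqueSizes t b) := by
  let φ := (e : _ →* DihedralGroup n).comp (QuotientGroup.mk' (Subgroup.center G))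
  have hφ : Function.Surjective φ := e.surjective.comp (QuotientGroup.mk'_surjective _)
  have hk : φ.ker = Subgroup.center G := by
    rw [MonoidHom.ker_mulEquiv_comp, QuotientGroup.ker_mk']
  obtain ⟨t, ht⟩ : 2 ∣ n.gcd 2 * (n - 1) := by
    rcases n.even_or_odd with hn | hn
    · exact (Nat.dvd_gcd hn.two_dvd dvd_rfl).mul_right _
    · exact (Nat.Odd.sub_odd hn odd_one).two_dvd.mul_left _
  have hb := gcd_two_mul_card_vertexKind_fiber_some hφ hk 0
  exact ⟨vertexKind φ, t, _, ht.symm, hb, isCliqueUnion_graph hφ hk ht.symm hb⟩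

end Vertices

end CCC

theorem mainTheorem3 {G : Type*} [Group G] [Finite G] (n z : ℕ) (hn : 3 ≤ n)
    (hz : Nat.card (Subgroup.center G) = z)
    (hG : Nonempty (G ⧸ Subgroup.center G ≃* DihedralGroup n)) :
    ((CCC.graph G).CNLBorderenergetic ↔ (n = 3 ∨ n = 11) ∧ z = 1) ∧
    ((CCC.graph G).CNLHyperenergetic ↔
      ¬ (((n = 3 ∨ n = 11) ∧ z = 1) ∨
        ((n = 4 ∨ n = 6) ∧ z = 2) ∨
        (n = 4 ∧ z = 3) ∨
        (n = 4 ∧ z = 4) ∨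
        (n = 3 ∧ 2 ≤ z) ∨
        ((n = 5 ∨ n = 7 ∨ n = 9) ∧ z = 1) ∨
        (n = 5 ∧ (z = 2 ∨ z = 3)))) ∧
    ((CCC.graph G).CNSLBorderenergetic ↔ n = 3 ∧ z = 1) ∧
    ((CCC.graph G).CNSLHyperenergetic ↔
      ¬ ((n = 3 ∧ z = 1) ∨
        (n = 4 ∧ (z = 2 ∨ z = 3 ∨ z = 4 ∨ z = 5)) ∨
        ((n = 6 ∨ n = 8) ∧ z = 2) ∨
        (n = 6 ∧ z = 3) ∨
        (n = 5 ∧ z = 1) ∨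
        (n = 3 ∧ 2 ≤ z) ∨
        (7 ≤ n ∧ Odd n ∧ z = 1) ∨
        ((n = 5 ∨ n = 7 ∨ n = 9) ∧ z = 2) ∨
        (n = 5 ∧ (z = 3 ∨ z = 4)))) := by
  have : NeZero n := ⟨by omega⟩
  have : NeZero (n.gcd 2) := ⟨Nat.gcd_ne_zero_right two_ne_zero⟩
  subst hz
  obtain ⟨f, t, b, ht, hb, H⟩ := CCC.exists_isCliqueUnion_graph hG.some
  have hb0 : 0 < b := Nat.pos_of_mul_pos_left (hb ▸ Nat.card_pos)
  rw [Nat.odd_iff]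
  rcases (Nat.dvd_prime Nat.prime_two).1 (n.gcd_dvd_right 2) with hgcd | hgcd <;>
    rw [hgcd] at ht hb <;> have hJ := (ZMod.card _).trans hgcd
  · obtain rfl | ht2 : t = 1 ∨ 2 ≤ t := by omega
    · rw [CCC.cliqueSizes_one] at H
      have hI : Fintype.card (Option (ZMod (n.gcd 2))) = 2 := by rw [Fintype.card_option, hJ]
      simp only [H.cnlBorderenergetic_iff_of_const hI hb0.ne',
        H.not_cnlHyperenergetic_of_const hI hb0.ne',
        H.cnslBorderenergetic_iff_of_const hI hb0.ne',
        H.not_cnslHyperenergetic_of_const hI hb0.ne']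
      and_intros <;> grind
    · simp only [H.cnlBorderenergetic_iff_of_card_eq_one hJ ht2 hb0,
        H.cnlHyperenergetic_iff_of_card_eq_one hJ ht2 hb0,
        H.not_cnslBorderenergetic_of_card_eq_one hJ ht2 hb0,
        H.cnslHyperenergetic_iff_of_card_eq_one hJ ht2 hb0]
      and_intros <;> grind
  · have two_dvd : 2 ∣ n := hgcd ▸ n.gcd_dvd_left 2
    have ht3 : 3 ≤ t := by omega
    simp only [H.not_cnlBorderenergetic_of_card_eq_two hJ ht3 hb0,
      H.cnlHyperenergetic_iff_of_card_eq_two hJ ht3 hb0,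
      H.not_cnslBorderenergetic_of_card_eq_two hJ ht3 hb0,
      H.cnslHyperenergetic_iff_of_card_eq_two hJ ht3 hb0]
    and_intros <;> grind
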